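/- Let $G$ be a locally compact (Hausdorff) group and let $1<p<\infty$. All Banach spaces are complex. A representation of $G$ on a Banach space $E$ is a homomorphism $\pi$ from $G$ into the group of invertible linear isometries of $E$ such that $x\mapsto\pi(x)\xi$ is continuous for every $\xi\in E$. Its coefficient functions are the functions $x\mapsto\langle\pi(x)\xi,\eta\rangle$ with $\xi\in E$, $\eta\in E^*$; such a function is called normalized if it can be written with $\|\xi\|=\|\eta\|=1$. A Banach space $E$ is smooth if for every $\xi\in E\setminus\{0\}$ there is a unique $\eta\in E^*$ with $\|\eta\|=1$ and $\langle\xi,\eta\rangle=\|\xi\|$. $B(G)$ is the set of all coefficient functions $u(x)=\langle\pi(x)\xi,\eta\rangle$ of continuous unitary representations $\pi$ of $G$ on Hilbert spaces, with $\|u\|_{B(G)}$ the infimum of $\|\xi\|\|\eta\|$ over all such expressions of $u$. A $QSL_p$-space is a Banach space isometrically isomorphic to a quotient, by a closed subspace, of a closed subspace of $L_p(X,\mu)$ for some measure space $(X,\mu)$. $\mathrm{Cyc}_p(G)$ is the class of representations $(\pi,E)$ of $G$ on $QSL_p$-spaces for which there is $\xi_0\in E$ with $\{\int_G f(x)\pi(x)\xi_0\,dx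 : f\in L_1(G)\}$ dense in $E$ (integration with respect to left Haar measure). $B_p(G)$ is the set of all functions $u:G\to\mathbb C$ of the form $$u(x)=\sum_{n=1}^\infty\langle\pi_n(x)\xi_n,\eta_n\rangle\quad(x\in G),\qquad (\pi_n,E_n)\in\mathrm{Cyc}_p(G),\ \xi_n\in E_n,\ \eta_n\in E_n^*,\ \sum_{n=1}^\infty\|\xi_n\|\|\eta_n\|<\infty,$$ with $\|u\|_{B_p(G)}$ the infimum of $\sum_n\|\xi_n\|\|\eta_n\|$ over all such expressions of $u$. Theorem. For a subset $C\subseteq G$, with indicator function $\chi_C$, the following are equivalent: (i) $C$ is an open left coset, i.e. $C=aH$ for some open subgroup $H$ of $G$ and some $a\in G$; (ii) $\chi_C\in B(G)$ and $\|\chi_C\|_{B(G)}=1$; (iii) $\chi_C\neq0$, and $\chi_C$ is a normalized coefficient function of a representation $(\pi,E)$ of $G$ on a Banach space $E$ such that $E$ or $E^*$ is smooth; (iv) $\chi_C\in B_p(G)$ and $\|\chi_C\|_{B_p(G)}=1$. -/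

import Mathlib

open MeasureTheory
open scoped ENNReal

universe u v w

noncomputable section

/-- A representation of a topological group `G` on a (complex) Banach space `E`: a group
homomorphism into the invertible linear isometries of `E` that is continuous for the strong
operator topology. -/
structure BanachRep (G : Type u) [Group G] [TopologicalSpace G]
    (E : Type w) [NormedAddCommGroup E] [NormedSpace ℂ E] where
  /-- The underlying homomorphism into the group of surjective linear isometries. -/
  toHom : G →* (E ≃ₗᵢ[ℂ] E)
  /-- Strong operator continuity. -/
  continuous_orbit : ∀ ξ : E, Continuous fun x : G => toHom x ξ

/-- The coefficient function `x ↦ ⟨π(x) ξ, η⟩` with `ξ ∈ E` and `η ∈ E*`. -/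
def BanachRep.coeff {G : Type u} [Group G] [TopologicalSpace G]
    {E : Type w} [NormedAddCommGroup E] [NormedSpace ℂ E]
    (π : BanachRep G E) (ξ : E) (η : StrongDual ℂ E) : G → ℂ :=
  fun x => η (π.toHom x ξ)

/-- `f` is a normalized coefficient function of `π`: one given by vectors of norm one. -/
def BanachRep.IsNormalizedCoeff {G : Type u} [Group G] [TopologicalSpace G]
    {E : Type w} [NormedAddCommGroup E] [NormedSpace ℂ E]
    (π : BanachRep G E) (f : G → ℂ) : Prop :=
  ∃ (ξ : E) (η : StrongDual ℂ E), ‖ξ‖ = 1 ∧ ‖η‖ = 1 ∧ f = π.coeff ξ η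

/-- The integrated form `π(f) ξ = ∫ f(x) π(x) ξ dx` (left Haar measure), for `f ∈ L¹(G)`.
For integrable `f` the integrand is Bochner integrable. -/
def BanachRep.integrated {G : Type u} [Group G] [TopologicalSpace G]
    [IsTopologicalGroup G] [LocallyCompactSpace G] [MeasurableSpace G] [BorelSpace G]
    {E : Type w} [NormedAddCommGroup E] [NormedSpace ℂ E]
    (π : BanachRep G E) (f : G → ℂ) (ξ : E) : E :=
  ∫ x, f x • π.toHom x ξ ∂(Measure.haar : Measure G)

/-- `π` is cyclic: `π(L¹(G)) ξ₀` is dense in `E` for some `ξ₀`. -/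
def BanachRep.IsCyclic {G : Type u} [Group G] [TopologicalSpace G]
    [IsTopologicalGroup G] [LocallyCompactSpace G] [MeasurableSpace G] [BorelSpace G]
    {E : Type w} [NormedAddCommGroup E] [NormedSpace ℂ E]
    (π : BanachRep G E) : Prop :=
  ∃ ξ₀ : E, Dense {ζ : E | ∃ f : G → ℂ,
    Integrable f (Measure.haar : Measure G) ∧ ζ = π.integrated f ξ₀}

/-- A normed space is smooth if every non-zero vector has exactly one norming functional of
norm one. -/
def IsSmoothSpace (E : Type w) [NormedAddCommGroup E] [NormedSpace ℂ E] : Prop :=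
  ∀ ξ : E, ξ ≠ 0 → ∃! η : StrongDual ℂ E, ‖η‖ = 1 ∧ η ξ = (‖ξ‖ : ℂ)

/-- `E` is a `QSL_p`-space: isometrically isomorphic to the quotient `S ⧸ N` of a closed
subspace `S` of some `L_p(X, μ)` by a closed subspace `N` of `S`. -/
def IsQSLSpace (p : ℝ≥0∞) [Fact (1 ≤ p)]
    (E : Type w) [NormedAddCommGroup E] [NormedSpace ℂ E] : Prop :=
  ∃ (X : Type w) (_ : MeasurableSpace X) (μ : Measure X)
    (S : Submodule ℂ (Lp ℂ p μ)) (N : Submodule ℂ S),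
    IsClosed (S : Set (Lp ℂ p μ)) ∧ IsClosed (N : Set S) ∧ Nonempty (E ≃ₗᵢ[ℂ] (S ⧸ N))

/-- The class `Cyc_p(G)` of cyclic representations of `G` on `QSL_p`-spaces. -/
structure CycRep (p : ℝ≥0∞) [Fact (1 ≤ p)] (G : Type u) [Group G] [TopologicalSpace G]
    [IsTopologicalGroup G] [LocallyCompactSpace G] [MeasurableSpace G] [BorelSpace G] where
  /-- The representation space. -/
  E : Type w
  [normedAddCommGroup : NormedAddCommGroup E]
  [normedSpace : NormedSpace ℂ E]
  [completeSpace : CompleteSpace E]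
  /-- The representation. -/
  rep : BanachRep G E
  isQSLSpace : IsQSLSpace p E
  isCyclic : rep.IsCyclic

attribute [instance] CycRep.normedAddCommGroup CycRep.normedSpace CycRep.completeSpace

/-- The values `∑ ‖ξ_n‖ ‖η_n‖ < ∞` over all expressions `u(x) = ∑ ⟨π_n(x) ξ_n, η_n⟩` with
`π_n ∈ Cyc_p(G)`. -/
def bpValues (p : ℝ≥0∞) [Fact (1 ≤ p)] {G : Type u} [Group G] [TopologicalSpace G]
    [IsTopologicalGroup G] [LocallyCompactSpace G] [MeasurableSpace G] [BorelSpace G]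
    (f : G → ℂ) : Set ℝ :=
  {c | ∃ (R : ℕ → CycRep.{u, w} p G) (ξ : ∀ n, (R n).E) (η : ∀ n, StrongDual ℂ (R n).E),
    HasSum (fun n => ‖ξ n‖ * ‖η n‖) c ∧
      ∀ x : G, HasSum (fun n => (R n).rep.coeff (ξ n) (η n) x) (f x)}

/-- The underlying set of `B_p(G)`. -/
def bpAlgebra (p : ℝ≥0∞) [Fact (1 ≤ p)] (G : Type u) [Group G] [TopologicalSpace G]
    [IsTopologicalGroup G] [LocallyCompactSpace G] [MeasurableSpace G] [BorelSpace G] :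
    Set (G → ℂ) :=
  {f | (bpValues.{u, w} p f).Nonempty}

/-- The norm of `B_p(G)` (meaningful on `bpAlgebra p G`). -/
def bpNorm (p : ℝ≥0∞) [Fact (1 ≤ p)] {G : Type u} [Group G] [TopologicalSpace G]
    [IsTopologicalGroup G] [LocallyCompactSpace G] [MeasurableSpace G] [BorelSpace G]
    (f : G → ℂ) : ℝ :=
  sInf (bpValues.{u, w} p f)

/-- The values `‖ξ‖ ‖η‖` over all expressions `f(x) = ⟨π(x) ξ, η⟩` with `π` a continuous
unitary representation of `G` on a Hilbert space (the invertible linear isometries of a Hilbert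
space are its unitaries). -/
def fourierStieltjesValues {G : Type u} [Group G] [TopologicalSpace G] (f : G → ℂ) : Set ℝ :=
  {c | ∃ (H : Type w) (_ : NormedAddCommGroup H) (_ : InnerProductSpace ℂ H)
    (_ : CompleteSpace H) (π : BanachRep G H) (ξ η : H),
    c = ‖ξ‖ * ‖η‖ ∧ ∀ x : G, f x = inner ℂ η (π.toHom x ξ)}

/-- The underlying set of the Fourier–Stieltjes algebra `B(G)`: all coefficient functions of
continuous unitary representations. -/
def fourierStieltjes (G : Type u) [Group G] [TopologicalSpace G] : Set (G → ℂ) :=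
  {f | (fourierStieltjesValues.{u, w} f).Nonempty}

/-- The norm of `B(G)` (meaningful on `fourierStieltjes G`). -/
def fourierStieltjesNorm {G : Type u} [Group G] [TopologicalSpace G] (f : G → ℂ) : ℝ :=
  sInf (fourierStieltjesValues.{u, w} f)

/-- `C` is an open left coset: `C = aH` for an open subgroup `H` and some `a`. -/
def IsOpenLeftCoset {G : Type u} [Group G] [TopologicalSpace G] (C : Set G) : Prop :=
  ∃ (H : Subgroup G) (a : G), IsOpen (H : Set G) ∧ C = (fun h => a * h) '' (H : Set G)

/-- The complex-valued indicator function of a set. -/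
def chi {G : Type u} (C : Set G) : G → ℂ := C.indicator fun _ => 1

end

/-! Suppose `χ_C` is a coefficient with `‖ξ‖ = ‖η‖ = 1`, and `a` and `ay` lie in `C`. The functional
`⟨π(a) · , η⟩` then takes its extreme value 1 at both `ξ` and `π(y)ξ`. In a strictly convex space
this forces `π(y)ξ = ξ`, so right translation by `y` preserves `C`; hence `a⁻¹C` is a subgroup, open
because `χ_C` is continuous.

The norms of `B(G)` and `B_p(G)` are infima, and in `B_p(G)` infinitely many spaces are involved, so
a quantitative version is needed. As `χ_C` takes only the values 0 and 1, it is enough that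
`χ_C(zy)` and `χ_C(z)` differ by less than 1. `HalfRotund` provides such an estimate in a form
linear in `‖ξ‖‖η‖` and the coefficients, so it can be summed over a series with one common constant,
without forming a direct sum (`isOpenLeftCoset_of_hasSum_coeff`). Hilbert spaces satisfy it by the
parallelogram law, and `QSL_p`-spaces by a scalar inequality that is integrated and passed to
quotients (`exists_halfRotund_of_isQSLSpace`). In (iii) the norms are attained, and uniqueness of
norming functionals replaces the estimate.

Conversely, for `C = aH`, the function `χ_C` is a matrix coefficient of the permutation
representation on `ℓ^p(G/H)`. -/

/-! ### Quantitative rotundity -/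

/-- A quantitative form of rotundity: two vectors of equal norm that are both almost normed by
the same functional are close to each other, up to half their norm. -/
def HalfRotund (K : ℝ) (E : Type*) [NormedAddCommGroup E] [NormedSpace ℂ E] : Prop :=
  ∀ (ξ ζ : E) (η : StrongDual ℂ E), ‖ξ‖ = ‖ζ‖ →
    ‖ξ - ζ‖ * ‖η‖ ≤ ‖ξ‖ * ‖η‖ / 2 + K * (2 * (‖ξ‖ * ‖η‖) - (η ξ).re - (η ζ).re)

/-- After rescaling, this follows because `Re η(ξ) + Re η(ζ) ≤ ‖ξ + ζ‖ ‖η‖`. -/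
theorem HalfRotund.of_unit {K : ℝ} (hK : 0 ≤ K) {E : Type*} [NormedAddCommGroup E]
    [NormedSpace ℂ E]
    (h : ∀ ξ ζ : E, ‖ξ‖ = 1 → ‖ζ‖ = 1 → ‖ξ - ζ‖ ≤ 1 / 2 + K * (2 - ‖ξ + ζ‖)) :
    HalfRotund K E := by
  intro ξ ζ η hn
  rcases eq_or_ne ξ 0 with rfl | hξ
  · have : ζ = 0 := by simpa using hn.symm
    simp [this]
  have hr : 0 < ‖ξ‖ := norm_pos_iff.2 hξ
  set r : ℝ := ‖ξ‖ with hrdef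
  have hnorm : ∀ v : E, ‖(r⁻¹ : ℂ) • v‖ = r⁻¹ * ‖v‖ := fun v => by
    rw [norm_smul]; simp [abs_of_pos hr]
  have h1 := h ((r⁻¹ : ℂ) • ξ) ((r⁻¹ : ℂ) • ζ)
    (by rw [hnorm, ← hrdef, inv_mul_cancel₀ hr.ne'])
    (by rw [hnorm, ← hn, inv_mul_cancel₀ hr.ne'])
  rw [← smul_sub, ← smul_add, hnorm, hnorm] at h1
  have h2 : ‖ξ - ζ‖ ≤ r / 2 + K * (2 * r - ‖ξ + ζ‖) := by
    have := mul_le_mul_of_nonneg_left h1 hr.le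
    have e : r * (1 / 2 + K * (2 - r⁻¹ * ‖ξ + ζ‖)) = r / 2 + K * (2 * r - ‖ξ + ζ‖) := by
      field_simp
    rwa [e, mul_inv_cancel_left₀ hr.ne'] at this
  have h3 : (η ξ).re + (η ζ).re ≤ ‖ξ + ζ‖ * ‖η‖ := by
    rw [← Complex.add_re, ← map_add, mul_comm]
    exact (Complex.re_le_norm _).trans (η.le_opNorm _)
  have h4 := mul_le_mul_of_nonneg_right h2 (norm_nonneg η)
  have h5 := mul_le_mul_of_nonneg_left h3 hK
  linarith

theorem halfRotund_of_innerProductSpace (H : Type*) [NormedAddCommGroup H]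
    [InnerProductSpace ℂ H] : HalfRotund 2 H := by
  refine HalfRotund.of_unit zero_le_two fun x y hx hy => ?_
  have h := parallelogram_law_with_norm ℂ x y
  rw [hx, hy] at h
  have h2 : ‖x + y‖ ≤ 2 := (norm_add_le x y).trans (by rw [hx, hy]; norm_num)
  -- With `t = ‖x - y‖` and `s = ‖x + y‖ ≤ 2`: `t ≤ 1/2 + t²/2` and `t² = 4 - s² ≤ 4(2 - s)`.
  nlinarith [sq_nonneg (‖x - y‖ - 1), norm_nonneg (x + y)]

theorem chi_apply_of_mem {G : Type u} {C : Set G} {x : G} (h : x ∈ C) : chi C x = 1 :=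
  Set.indicator_of_mem h _

theorem chi_apply_of_notMem {G : Type u} {C : Set G} {x : G} (h : x ∉ C) : chi C x = 0 :=
  Set.indicator_of_notMem h _

theorem mem_iff_of_norm_chi_sub_lt_one {G : Type u} {C : Set G} {x y : G}
    (h : ‖chi C x - chi C y‖ < 1) : x ∈ C ↔ y ∈ C := by
  by_cases hx : x ∈ C <;> by_cases hy : y ∈ C <;>
    simp [hx, hy, chi_apply_of_mem, chi_apply_of_notMem] at h ⊢

theorem isOpen_of_continuous_chi {G : Type u} [TopologicalSpace G] {C : Set G}
    (h : Continuous (chi C)) : IsOpen C := by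
  have : C = chi C ⁻¹' {0}ᶜ := by
    ext x
    by_cases hx : x ∈ C <;> simp [hx, chi_apply_of_mem, chi_apply_of_notMem]
  rw [this]
  exact isOpen_compl_singleton.preimage h

/-! ### From near-extremal coefficients to cosets -/

section Coset

variable {G : Type u} [Group G] [TopologicalSpace G]

/-- The subgroup is `a⁻¹C`: by hypothesis its elements preserve `C` under right translation, which
gives closure under products and inverses. -/
theorem isOpenLeftCoset_of_forall_mul_mem_iff [ContinuousMul G] {C : Set G} (hC : IsOpen C) {a : G}
    (ha : a ∈ C) (h : ∀ y, a * y ∈ C → ∀ z, z * y ∈ C ↔ z ∈ C) : IsOpenLeftCoset C := by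
  refine ⟨{ carrier := {y | a * y ∈ C}, mul_mem' := ?_, one_mem' := ?_, inv_mem' := ?_ }, a,
    hC.preimage (continuous_const_mul a), ?_⟩
  · intro x y hx hy
    have := (h y hy (a * x)).2 hx
    rwa [mul_assoc] at this
  · simpa using ha
  · intro x hx
    refine (h x hx _).1 ?_
    simpa using ha
  · ext x
    refine ⟨fun hx => ⟨a⁻¹ * x, by simpa using hx, by simp⟩, ?_⟩
    rintro ⟨y, hy, rfl⟩
    exact hy

variable {E : Type*} [NormedAddCommGroup E] [NormedSpace ℂ E]

/-- The functional `⟨π(a) · , η⟩`. -/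
noncomputable def BanachRep.translateDual (π : BanachRep G E) (η : StrongDual ℂ E) (a : G) : StrongDual ℂ E :=
  η.comp ((π.toHom a).toContinuousLinearEquiv : E →L[ℂ] E)

theorem BanachRep.translateDual_apply (π : BanachRep G E) (η : StrongDual ℂ E) (a : G) (ξ : E) :
    π.translateDual η a ξ = η (π.toHom a ξ) := rfl

theorem BanachRep.norm_translateDual (π : BanachRep G E) (η : StrongDual ℂ E) (a : G) :
    ‖π.translateDual η a‖ = ‖η‖ :=
  ContinuousLinearMap.opNorm_comp_linearIsometryEquiv η (π.toHom a)

theorem BanachRep.coeff_mul (π : BanachRep G E) (ξ : E) (η : StrongDual ℂ E) (x y : G) :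
    π.coeff ξ η (x * y) = η (π.toHom x (π.toHom y ξ)) := by
  simp [BanachRep.coeff, map_mul]

theorem BanachRep.continuous_coeff (π : BanachRep G E) (ξ : E) (η : StrongDual ℂ E) :
    Continuous (π.coeff ξ η) := η.continuous.comp (π.continuous_orbit ξ)

theorem BanachRep.norm_coeff_le (π : BanachRep G E) (ξ : E) (η : StrongDual ℂ E) (x : G) :
    ‖π.coeff ξ η x‖ ≤ ‖ξ‖ * ‖η‖ := by
  rw [mul_comm]
  exact (η.le_opNorm _).trans_eq (by rw [LinearIsometryEquiv.norm_map])

/-- Rotundity is applied to `π(y)ξ` and `ξ` with the functional translated by `a`. Since `π(z)` is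
isometric, the resulting bound does not depend on `z`. -/
theorem BanachRep.norm_coeff_mul_sub_le (π : BanachRep G E) {K : ℝ} (hE : HalfRotund K E) (ξ : E)
    (η : StrongDual ℂ E) (a y z : G) :
    ‖π.coeff ξ η (z * y) - π.coeff ξ η z‖ ≤ ‖ξ‖ * ‖η‖ / 2 +
      K * (2 * (‖ξ‖ * ‖η‖) - (π.coeff ξ η (a * y)).re - (π.coeff ξ η a).re) := by
  have h1 := hE (π.toHom y ξ) ξ (π.translateDual η a) (LinearIsometryEquiv.norm_map _ _)
  rw [π.norm_translateDual, LinearIsometryEquiv.norm_map, π.translateDual_apply,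
    π.translateDual_apply, ← π.coeff_mul] at h1
  refine le_trans ?_ h1
  rw [π.coeff_mul, BanachRep.coeff, ← map_sub, ← map_sub, mul_comm]
  exact (η.le_opNorm _).trans_eq (by rw [LinearIsometryEquiv.norm_map])

theorem isOpenLeftCoset_of_hasSum_coeff [ContinuousMul G] {C : Set G} (hC : C.Nonempty) {K : ℝ}
    {E : ℕ → Type*} [∀ n, NormedAddCommGroup (E n)] [∀ n, NormedSpace ℂ (E n)]
    (π : ∀ n, BanachRep G (E n)) (hE : ∀ n, HalfRotund K (E n)) (ξ : ∀ n, E n)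
    (η : ∀ n, StrongDual ℂ (E n)) {c : ℝ} (hc : HasSum (fun n => ‖ξ n‖ * ‖η n‖) c)
    (hcK : c / 2 + K * (2 * c - 1 - 1) < 1)
    (hu : ∀ x, HasSum (fun n => (π n).coeff (ξ n) (η n) x) (chi C x)) : IsOpenLeftCoset C := by
  obtain ⟨a, ha⟩ := hC
  refine isOpenLeftCoset_of_forall_mul_mem_iff (a := a) (isOpen_of_continuous_chi ?_) ha ?_
  · rw [funext fun x => (hu x).tsum_eq.symm]
    exact continuous_tsum (fun n => (π n).continuous_coeff _ _) hc.summable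
      fun n x => (π n).norm_coeff_le _ _ _
  · intro y hy z
    refine mem_iff_of_norm_chi_sub_lt_one (lt_of_le_of_lt ?_ hcK)
    have key : ∀ x ∈ C, HasSum (fun n => ((π n).coeff (ξ n) (η n) x).re) 1 := by
      intro x hx
      have := Complex.hasSum_re (hu x)
      rwa [chi_apply_of_mem hx, Complex.one_re] at this
    -- The rotundity bounds are linear in the summands, so they add up to `c / 2 + K * (2 * c - 1 -
    -- 1)`.
    have hb := (hc.div_const 2).add ((((hc.mul_left 2).sub (key _ hy)).sub (key _ ha)).mul_left K)
    rw [← ((hu (z * y)).sub (hu z)).tsum_eq]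
    exact tsum_of_norm_bounded hb fun n => (π n).norm_coeff_mul_sub_le (hE n) _ _ _ _ _

/-- At `c = 1` the expression equals `1/2`, which leaves room for a small excess. -/
theorem exists_pos_forall_lt_half_add_lt_one (K : ℝ) :
    ∃ ε > 0, ∀ c : ℝ, 0 ≤ c - 1 → c < 1 + ε → c / 2 + K * (2 * c - 1 - 1) < 1 := by
  refine ⟨1 / (2 * (2 * |K| + 1)), by positivity, fun c hc0 hc => ?_⟩
  have hpos : 0 < 2 * (2 * |K| + 1) := by positivity
  have h1 : (c - 1) * (2 * (2 * |K| + 1)) < 1 := by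
    rw [← lt_div_iff₀ hpos]; linarith
  nlinarith [mul_le_mul_of_nonneg_right (le_abs_self K) hc0]

/-- A single coefficient becomes a series concentrated at index 0, so the argument for series also
covers `B(G)`. -/
theorem hasSum_norm_single_mul_norm (ξ : E) (η : StrongDual ℂ E) :
    HasSum (fun n : ℕ => ‖(Pi.single 0 ξ : ℕ → E) n‖ * ‖η‖) (‖ξ‖ * ‖η‖) := by
  convert hasSum_single (0 : ℕ) (fun n hn => ?_) using 1 <;> simp_all

theorem BanachRep.hasSum_coeff_single (π : BanachRep G E) (ξ : E) (η : StrongDual ℂ E) (x : G) :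
    HasSum (fun n : ℕ => π.coeff ((Pi.single 0 ξ : ℕ → E) n) η x) (π.coeff ξ η x) := by
  convert hasSum_single (0 : ℕ) (fun n hn => ?_) using 1 <;> simp_all [BanachRep.coeff]

end Coset

/-! ### Each analytic condition yields a coset -/

section CosetOfCoefficient

variable {G : Type u} [Group G] [TopologicalSpace G]

theorem one_le_of_hasSum_coeff {C : Set G} (hC : C.Nonempty) {E : ℕ → Type*}
    [∀ n, NormedAddCommGroup (E n)] [∀ n, NormedSpace ℂ (E n)] (π : ∀ n, BanachRep G (E n))
    (ξ : ∀ n, E n) (η : ∀ n, StrongDual ℂ (E n)) {c : ℝ}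
    (hc : HasSum (fun n => ‖ξ n‖ * ‖η n‖) c)
    (hu : ∀ x, HasSum (fun n => (π n).coeff (ξ n) (η n) x) (chi C x)) : 1 ≤ c := by
  obtain ⟨a, ha⟩ := hC
  have h := tsum_of_norm_bounded hc fun n => (π n).norm_coeff_le (ξ n) (η n) a
  rwa [(hu a).tsum_eq, chi_apply_of_mem ha, norm_one] at h

theorem isOpenLeftCoset_of_bpNorm_eq_one [IsTopologicalGroup G] [LocallyCompactSpace G]
    [MeasurableSpace G] [BorelSpace G] {p : ℝ≥0∞} [Fact (1 ≤ p)] {K : ℝ}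
    (hK : ∀ (E : Type w) [NormedAddCommGroup E] [NormedSpace ℂ E], IsQSLSpace p E → HalfRotund K E)
    {C : Set G} (hmem : chi C ∈ bpAlgebra.{u, w} p G) (hnorm : bpNorm.{u, w} p (chi C) = 1) :
    IsOpenLeftCoset C := by
  have hbdd : BddBelow (bpValues.{u, w} p (chi C)) := by
    refine ⟨0, ?_⟩
    rintro c ⟨R, ξ, η, hc, -⟩
    exact hc.nonneg fun n => by positivity
  have hC : C.Nonempty := by
    rw [Set.nonempty_iff_ne_empty]
    rintro rfl
    obtain ⟨c, R, ξ, η, -, -⟩ := hmem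
    -- The empty set is excluded because the zero function has norm 0.
    have h0 : (0 : ℝ) ∈ bpValues.{u, w} p (chi (∅ : Set G)) :=
      ⟨R, 0, 0, by simp,
        fun x => by simp [BanachRep.coeff, chi]⟩
    have := csInf_le hbdd h0
    rw [bpNorm] at hnorm
    linarith
  obtain ⟨ε, hε, h⟩ := exists_pos_forall_lt_half_add_lt_one K
  obtain ⟨c, ⟨R, ξ, η, hc, hu⟩, hlt⟩ :=
    exists_lt_of_csInf_lt hmem (show sInf (bpValues.{u, w} p (chi C)) < 1 + ε by
      rw [bpNorm] at hnorm; linarith)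
  have h1 := one_le_of_hasSum_coeff hC (fun n => (R n).rep) ξ η hc hu
  exact isOpenLeftCoset_of_hasSum_coeff hC (fun n => (R n).rep) (fun n => hK _ (R n).isQSLSpace)
    ξ η hc (h c (by linarith) hlt) hu

theorem isOpenLeftCoset_of_fourierStieltjesNorm_eq_one [ContinuousMul G] {C : Set G}
    (hmem : chi C ∈ fourierStieltjes.{u, w} G)
    (hnorm : fourierStieltjesNorm.{u, w} (chi C) = 1) : IsOpenLeftCoset C := by
  have hbdd : BddBelow (fourierStieltjesValues.{u, w} (chi C)) := by
    refine ⟨0, ?_⟩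
    rintro c ⟨H, _, _, _, π, ξ, η, rfl, -⟩
    positivity
  have hC : C.Nonempty := by
    rw [Set.nonempty_iff_ne_empty]
    rintro rfl
    obtain ⟨c, H, i₁, i₂, i₃, π, ξ, η, -, -⟩ := hmem
    have h0 : (0 : ℝ) ∈ fourierStieltjesValues.{u, w} (chi (∅ : Set G)) :=
      ⟨H, i₁, i₂, i₃, π, 0, 0, by simp, fun x => by simp [chi]⟩
    have := csInf_le hbdd h0
    rw [fourierStieltjesNorm] at hnorm
    linarith
  obtain ⟨ε, hε, h⟩ := exists_pos_forall_lt_half_add_lt_one 2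
  obtain ⟨c, ⟨H, i₁, i₂, i₃, π, ξ, η, rfl, hu⟩, hlt⟩ :=
    exists_lt_of_csInf_lt hmem (show sInf (fourierStieltjesValues.{u, w} (chi C)) < 1 + ε by
      rw [fourierStieltjesNorm] at hnorm; linarith)
  have hc := hasSum_norm_single_mul_norm ξ (InnerProductSpace.toDual ℂ H η)
  rw [LinearIsometryEquiv.norm_map] at hc
  have hu' : ∀ x, HasSum (fun n : ℕ => π.coeff ((Pi.single 0 ξ : ℕ → H) n)
      (InnerProductSpace.toDual ℂ H η) x) (chi C x) := fun x => by
    rw [hu x]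
    exact π.hasSum_coeff_single ξ _ x
  have h1 := one_le_of_hasSum_coeff hC (fun _ => π) _
    (fun _ => InnerProductSpace.toDual ℂ H η) (by simpa using hc) hu'
  exact isOpenLeftCoset_of_hasSum_coeff hC (fun _ => π)
    (fun _ => halfRotund_of_innerProductSpace H) _
    (fun _ => InnerProductSpace.toDual ℂ H η) (by simpa using hc) (h _ (by linarith) hlt) hu'

theorem isOpenLeftCoset_of_isNormalizedCoeff [ContinuousMul G] {C : Set G} (hC : chi C ≠ 0)
    {E : Type w} [NormedAddCommGroup E] [NormedSpace ℂ E] (π : BanachRep G E)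
    (hE : IsSmoothSpace E ∨ IsSmoothSpace (StrongDual ℂ E)) (hπ : π.IsNormalizedCoeff (chi C)) :
    IsOpenLeftCoset C := by
  obtain ⟨ξ, η, hξ, hη, hu⟩ := hπ
  have hne : C.Nonempty := by
    rw [Set.nonempty_iff_ne_empty]
    rintro rfl
    exact hC (Set.indicator_empty _)
  obtain ⟨a, ha⟩ := hne
  have hmem : ∀ x ∈ C, η (π.toHom x ξ) = 1 := fun x hx => by
    rw [← chi_apply_of_mem hx, hu, BanachRep.coeff]
  have hiff : ∀ x z : G, chi C x = chi C z → (x ∈ C ↔ z ∈ C) := fun x z h =>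
    mem_iff_of_norm_chi_sub_lt_one (by simp [h])
  have hopen : IsOpen C := isOpen_of_continuous_chi (hu ▸ π.continuous_coeff ξ η)
  rcases hE with hE | hE
  -- `E` smooth: the translates of `η` by elements of `C` all norm `ξ`, so they are one functional
  -- `η₀`, and `C` is exactly the set where the translate equals `η₀`.
  · obtain ⟨η₀, -, huniq⟩ := hE ξ (norm_ne_zero_iff.1 (by rw [hξ]; exact one_ne_zero))
    have htrans : ∀ x ∈ C, π.translateDual η x = η₀ := fun x hx =>
      huniq _ ⟨by rw [π.norm_translateDual, hη],
        by rw [π.translateDual_apply, hmem x hx, hξ, Complex.ofReal_one]⟩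
    have hcoset : ∀ x, x ∈ C ↔ π.translateDual η x = η₀ := fun x =>
      ⟨htrans x, fun h => (hiff x a (by
        rw [hu, BanachRep.coeff, ← π.translateDual_apply, h, ← htrans a ha]; rfl)).2 ha⟩
    refine isOpenLeftCoset_of_forall_mul_mem_iff hopen ha fun y hy z => ?_
    have hmul : ∀ x v, π.translateDual η (x * y) v = π.translateDual η x (π.toHom y v) :=
      fun x v => π.coeff_mul v η x y
    have hη₀ : ∀ v, η₀ (π.toHom y v) = η₀ v := fun v => by
      rw [← htrans a ha, ← hmul, htrans _ hy, htrans a ha]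
    rw [hcoset, hcoset]
    refine ⟨fun h => ?_, fun h => ?_⟩ <;> ext v
    · obtain ⟨v, rfl⟩ := (π.toHom y).surjective v
      rw [← hmul, h, hη₀]
    · rw [hmul, h, hη₀]
  -- `E*` smooth: the vectors `π(x)ξ` with `x ∈ C`, seen in the bidual, all norm `η`, so they
  -- coincide; hence `y` fixes `ξ`.
  · have hη0 : η ≠ 0 := norm_ne_zero_iff.1 (by rw [hη]; exact one_ne_zero)
    have hnorm : ∀ v : E, ‖v‖ = 1 → ‖NormedSpace.inclusionInDoubleDual ℂ E v‖ = 1 := fun v hv =>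
      ((NormedSpace.inclusionInDoubleDualLi ℂ).norm_map v).trans hv
    have hfix : ∀ x ∈ C, ∀ z ∈ C, π.toHom x ξ = π.toHom z ξ := fun x hx z hz => by
      have h : ∀ x ∈ C, ‖NormedSpace.inclusionInDoubleDual ℂ E (π.toHom x ξ)‖ = 1 ∧
          NormedSpace.inclusionInDoubleDual ℂ E (π.toHom x ξ) η = (‖η‖ : ℂ) := fun x hx =>
        ⟨hnorm _ (by rw [LinearIsometryEquiv.norm_map, hξ]), by
          rw [NormedSpace.dual_def, hmem x hx, hη, Complex.ofReal_one]⟩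
      exact (NormedSpace.inclusionInDoubleDualLi ℂ).injective
        ((hE η hη0).unique (h x hx) (h z hz))
    refine isOpenLeftCoset_of_forall_mul_mem_iff hopen ha fun y hy z => hiff _ _ ?_
    have hy' : π.toHom y ξ = ξ := by
      have := hfix _ hy a ha
      rw [map_mul] at this
      exact (π.toHom a).injective this
    rw [hu, π.coeff_mul, hy', BanachRep.coeff]

end CosetOfCoefficient

/-! ### Uniform rotundity of `QSL_p`-spaces -/

section QSL

/-- Strictness comes from strict convexity of the modulus when `‖a‖ = ‖b‖`, and of `t ↦ t ^ p`
otherwise. -/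
theorem norm_half_add_rpow_lt {p : ℝ} (hp : 1 < p) {a b : ℂ} (hab : a ≠ b) :
    ‖(a + b) / 2‖ ^ p < (‖a‖ ^ p + ‖b‖ ^ p) / 2 := by
  have hnorm : ‖(a + b) / 2‖ = ‖a + b‖ / 2 := by simp
  rcases eq_or_ne ‖a‖ ‖b‖ with h | h
  · have h1 : ‖a + b‖ < ‖a‖ + ‖b‖ :=
      norm_add_lt_of_not_sameRay fun hs => hab (hs.eq_of_norm_eq h)
    have h2 : ‖(a + b) / 2‖ < ‖a‖ := by rw [hnorm]; linarith
    calc ‖(a + b) / 2‖ ^ p < ‖a‖ ^ p := Real.rpow_lt_rpow (norm_nonneg _) h2 (by linarith)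
      _ = _ := by rw [← h]; ring
  · have h1 := (strictConvexOn_rpow hp).2 (norm_nonneg a) (norm_nonneg b) h
      (show (0 : ℝ) < 1 / 2 by norm_num) (show (0 : ℝ) < 1 / 2 by norm_num) (by norm_num)
    simp only [smul_eq_mul] at h1
    refine lt_of_le_of_lt (Real.rpow_le_rpow (norm_nonneg _) ?_ (by linarith))
      (h1.trans_eq (by ring))
    rw [hnorm]
    linarith [norm_add_le a b]

/-- By homogeneity it suffices to treat the unit sphere of `ℂ × ℂ`. Where `F ≥ 0` there, `a ≠ b`, so
the convexity defect `D` is positive on a compact set and `F / D` is bounded. -/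
theorem exists_norm_sub_rpow_le {p : ℝ} (hp : 1 < p) {δ : ℝ} (hδ : 0 < δ) :
    ∃ K : ℝ, 0 ≤ K ∧ ∀ a b : ℂ, ‖a - b‖ ^ p ≤ δ * (‖a‖ ^ p + ‖b‖ ^ p) +
      K * ((‖a‖ ^ p + ‖b‖ ^ p) / 2 - ‖(a + b) / 2‖ ^ p) := by
  have hp0 : 0 < p := by linarith
  let D : ℂ × ℂ → ℝ := fun z => (‖z.1‖ ^ p + ‖z.2‖ ^ p) / 2 - ‖(z.1 + z.2) / 2‖ ^ p
  let F : ℂ × ℂ → ℝ := fun z => ‖z.1 - z.2‖ ^ p - δ * (‖z.1‖ ^ p + ‖z.2‖ ^ p)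
  have hpow : Continuous fun t : ℝ => t ^ p := Real.continuous_rpow_const hp0.le
  have hDc : Continuous D := by
    have h1 : Continuous fun z : ℂ × ℂ => ‖z.1‖ ^ p := hpow.comp (by fun_prop)
    have h2 : Continuous fun z : ℂ × ℂ => ‖z.2‖ ^ p := hpow.comp (by fun_prop)
    have h3 : Continuous fun z : ℂ × ℂ => ‖(z.1 + z.2) / 2‖ ^ p := hpow.comp (by fun_prop)
    exact ((h1.add h2).div_const 2).sub h3
  have hFc : Continuous F := by
    have h1 : Continuous fun z : ℂ × ℂ => ‖z.1‖ ^ p := hpow.comp (by fun_prop)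
    have h2 : Continuous fun z : ℂ × ℂ => ‖z.2‖ ^ p := hpow.comp (by fun_prop)
    have h3 : Continuous fun z : ℂ × ℂ => ‖z.1 - z.2‖ ^ p := hpow.comp (by fun_prop)
    exact h3.sub ((h1.add h2).const_mul δ)
  have hD0 : ∀ z, 0 ≤ D z := fun z => by
    by_cases h : z.1 = z.2
    · simp only [D, h, ← two_mul]
      rw [mul_div_cancel_left₀ _ two_ne_zero, mul_div_cancel_left₀ _ two_ne_zero, sub_self]
    · exact (sub_pos.2 (norm_half_add_rpow_lt hp h)).le
  obtain ⟨K, hK, hS⟩ : ∃ K : ℝ, 0 ≤ K ∧ ∀ z ∈ Metric.sphere (0 : ℂ × ℂ) 1, F z ≤ K * D z := by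
    have hc : IsCompact (Metric.sphere (0 : ℂ × ℂ) 1 ∩ F ⁻¹' Set.Ici 0) :=
      (isCompact_sphere _ _).inter_right (isClosed_Ici.preimage hFc)
    have hpos : ∀ z ∈ Metric.sphere (0 : ℂ × ℂ) 1 ∩ F ⁻¹' Set.Ici 0, 0 < D z := by
      rintro z ⟨hz, hFz⟩
      refine sub_pos.2 (norm_half_add_rpow_lt hp fun h => ?_)
      have h0 : z.1 ≠ 0 := fun h0 => by
        have : z = 0 := Prod.ext h0 (h ▸ h0)
        simp [this] at hz
      have : 0 < ‖z.1‖ ^ p := Real.rpow_pos_of_pos (norm_pos_iff.2 h0) _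
      have hFz' : 0 ≤ F z := hFz
      simp only [F, ← h, sub_self, norm_zero, Real.zero_rpow hp0.ne'] at hFz'
      nlinarith
    obtain ⟨K, hK⟩ := hc.exists_bound_of_continuousOn (f := fun z => F z / D z)
      (hFc.continuousOn.div hDc.continuousOn fun z hz => (hpos z hz).ne')
    refine ⟨max K 0, le_max_right _ _, fun z hz => ?_⟩
    rcases le_or_gt 0 (F z) with hF | hF
    · have h1 := (le_abs_self _).trans (hK z ⟨hz, hF⟩)
      rw [div_le_iff₀ (hpos z ⟨hz, hF⟩)] at h1
      exact h1.trans (mul_le_mul_of_nonneg_right (le_max_left _ _) (hD0 z))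
    · exact hF.le.trans (mul_nonneg (le_max_right _ _) (hD0 z))
  refine ⟨K, hK, fun a b => ?_⟩
  rcases eq_or_ne (a, b) 0 with h | h
  · obtain ⟨rfl, rfl⟩ := Prod.mk.inj h
    simp [Real.zero_rpow hp0.ne']
  set r : ℝ := ‖(a, b)‖ with hr
  have hr0 : 0 < r := norm_pos_iff.2 h
  have hsc : ∀ v : ℂ, ‖v / r‖ ^ p = ‖v‖ ^ p / r ^ p := fun v => by
    rw [norm_div, Complex.norm_real, Real.norm_of_nonneg hr0.le,
      Real.div_rpow (norm_nonneg _) hr0.le]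
  have hz := hS (a / r, b / r) (by
    rw [mem_sphere_zero_iff_norm]
    have : ((a / r, b / r) : ℂ × ℂ) = (r⁻¹ : ℝ) • (a, b) := by
      ext <;> simp [div_eq_inv_mul]
    rw [this, norm_smul, ← hr, norm_inv, Real.norm_of_nonneg hr0.le, inv_mul_cancel₀ hr0.ne'])
  simp only [F, D, ← sub_div, ← add_div] at hz
  rw [div_right_comm (a + b), hsc, hsc, hsc, hsc] at hz
  have hrp : 0 < r ^ p := Real.rpow_pos_of_pos hr0 _
  have := mul_le_mul_of_nonneg_right hz hrp.le
  have e1 : (‖a - b‖ ^ p / r ^ p - δ * (‖a‖ ^ p / r ^ p + ‖b‖ ^ p / r ^ p)) * r ^ p =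
    ‖a - b‖ ^ p - δ * (‖a‖ ^ p + ‖b‖ ^ p) := by field_simp
  have e2 : K * ((‖a‖ ^ p / r ^ p + ‖b‖ ^ p / r ^ p) / 2 - ‖(a + b) / 2‖ ^ p / r ^ p) * r ^ p =
    K * ((‖a‖ ^ p + ‖b‖ ^ p) / 2 - ‖(a + b) / 2‖ ^ p) := by field_simp
  rw [e1, e2] at this
  linarith

theorem Lp_norm_rpow_eq_integral {X : Type*} [MeasurableSpace X] {μ : Measure X} {p : ℝ≥0∞}
    (hp0 : p ≠ 0) (hp : p ≠ ∞) (f : Lp ℂ p μ) :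
    ‖f‖ ^ p.toReal = ∫ x, ‖f x‖ ^ p.toReal ∂μ := by
  have hpos : 0 < p.toReal := ENNReal.toReal_pos hp0 hp
  have h0 : 0 ≤ ∫ x, ‖f x‖ ^ p.toReal ∂μ := integral_nonneg fun x => by positivity
  rw [Lp.norm_def, (Lp.memLp f).eLpNorm_eq_integral_rpow_norm hp0 hp,
    ENNReal.toReal_ofReal (by positivity), Real.rpow_inv_rpow h0 hpos.ne']

/-- An `ℓ^q`-form of uniform rotundity, for a fixed separation `δ`. -/
def RpowRotund (q δ K : ℝ) (V : Type*) [SeminormedAddCommGroup V] [NormedSpace ℂ V] : Prop :=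
  ∀ x y : V, ‖x - y‖ ^ q ≤ δ * (‖x‖ ^ q + ‖y‖ ^ q) +
    K * ((‖x‖ ^ q + ‖y‖ ^ q) / 2 - ‖(2⁻¹ : ℂ) • (x + y)‖ ^ q)

/-- The scalar inequality is linear in `p`-th powers, so it integrates with the same constants over
every measure space. -/
theorem rpowRotund_Lp {X : Type*} [MeasurableSpace X] {μ : Measure X} {p : ℝ≥0∞}
    [Fact (1 ≤ p)] (hp : p ≠ ∞) {δ K : ℝ}
    (h : ∀ a b : ℂ, ‖a - b‖ ^ p.toReal ≤ δ * (‖a‖ ^ p.toReal + ‖b‖ ^ p.toReal) +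
      K * ((‖a‖ ^ p.toReal + ‖b‖ ^ p.toReal) / 2 - ‖(a + b) / 2‖ ^ p.toReal)) : RpowRotund p.toReal δ K (Lp ℂ p μ) := by
  intro f g
  have hp0 : p ≠ 0 := (zero_lt_one.trans_le (Fact.out : 1 ≤ p)).ne'
  have hint : ∀ f : Lp ℂ p μ, Integrable (fun x => ‖f x‖ ^ p.toReal) μ := fun f =>
    (Lp.memLp f).integrable_norm_rpow hp0 hp
  simp only [Lp_norm_rpow_eq_integral hp0 hp]
  have hfg : Integrable (fun x => ‖f x‖ ^ p.toReal + ‖g x‖ ^ p.toReal) μ := (hint f).add (hint g)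
  have hD : Integrable (fun x => (‖f x‖ ^ p.toReal + ‖g x‖ ^ p.toReal) / 2 -
      ‖((2⁻¹ : ℂ) • (f + g)) x‖ ^ p.toReal) μ := (hfg.div_const 2).sub (hint _)
  rw [← integral_add (hint f) (hint g), ← integral_div, ← integral_sub (hfg.div_const 2) (hint _),
    ← integral_const_mul, ← integral_const_mul,
    ← integral_add (hfg.const_mul δ) (hD.const_mul K)]
  refine integral_mono_ae (hint _) ((hfg.const_mul δ).add (hD.const_mul K)) ?_
  filter_upwards [Lp.coeFn_sub f g, Lp.coeFn_add f g, Lp.coeFn_smul (2⁻¹ : ℂ) (f + g)]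
    with x h1 h2 h3
  have h4 := h (f x) (g x)
  simp only [h1, h3, h2, Pi.sub_apply, Pi.smul_apply, Pi.add_apply, smul_eq_mul]
  rwa [← div_eq_inv_mul]

/-- Lift `x` and `y` with almost the same norms. Passing to the quotient can only shrink the
difference and the midpoint, and both changes favour the inequality. -/
theorem RpowRotund.of_quotient {q δ K : ℝ} (hq : 0 ≤ q) (hK : 0 ≤ K) {V : Type*}
    [NormedAddCommGroup V] [NormedSpace ℂ V] (hV : RpowRotund q δ K V) (N : Submodule ℂ V)
    {E : Type*} [NormedAddCommGroup E] [NormedSpace ℂ E] (e : E ≃ₗᵢ[ℂ] (V ⧸ N)) :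
    RpowRotund q δ K E := by
  intro x y
  have hlift : ∀ x : E, ∀ n : ℕ, ∃ f : V, Submodule.Quotient.mk f = e x ∧
      ‖f‖ < ‖x‖ + 1 / ((n : ℝ) + 1) := fun x n => by
    have := Submodule.Quotient.norm_mk_lt (e x) (ε := 1 / ((n : ℝ) + 1)) (by positivity)
    rwa [e.norm_map] at this
  have hlim : ∀ (x : E) (f : ℕ → V), (∀ n, Submodule.Quotient.mk (f n) = e x ∧
      ‖f n‖ < ‖x‖ + 1 / ((n : ℝ) + 1)) →
      Filter.Tendsto (fun n => ‖f n‖ ^ q) Filter.atTop (nhds (‖x‖ ^ q)) := by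
    intro x f hf
    refine ((Real.continuous_rpow_const hq).tendsto _).comp ?_
    refine tendsto_of_tendsto_of_tendsto_of_le_of_le tendsto_const_nhds
      (by simpa using tendsto_one_div_add_atTop_nhds_zero_nat.const_add ‖x‖)
      (fun n => ?_) fun n => (hf n).2.le
    rw [← e.norm_map, ← (hf n).1]
    exact Submodule.Quotient.norm_mk_le _ _
  choose f hf using hlift x
  choose g hg using hlift y
  have hf' := hlim x f hf
  have hg' := hlim y g hg
  refine ge_of_tendsto' (((hf'.add hg').const_mul δ).add
    ((((hf'.add hg').div_const 2).sub_const _).const_mul K)) fun n => ?_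
  have hb : ‖x - y‖ ≤ ‖f n - g n‖ := by
    rw [← e.norm_map, e.map_sub, ← (hf n).1, ← (hg n).1]
    exact Submodule.Quotient.norm_mk_le N (f n - g n)
  have hm : ‖(2⁻¹ : ℂ) • (x + y)‖ ≤ ‖(2⁻¹ : ℂ) • (f n + g n)‖ := by
    rw [← e.norm_map, e.map_smul, e.map_add, ← (hf n).1, ← (hg n).1]
    exact Submodule.Quotient.norm_mk_le N ((2⁻¹ : ℂ) • (f n + g n))
  have h1 := Real.rpow_le_rpow (norm_nonneg _) hb hq
  have h2 := mul_le_mul_of_nonneg_left (Real.rpow_le_rpow (norm_nonneg _) hm hq) hK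
  have h3 := hV (f n) (g n)
  rw [mul_sub] at h3 ⊢
  linarith

theorem RpowRotund.of_isQSLSpace {p : ℝ≥0∞} [Fact (1 ≤ p)] {δ K : ℝ} (hK : 0 ≤ K)
    (h : ∀ (X : Type w) [MeasurableSpace X] (μ : Measure X), RpowRotund p.toReal δ K (Lp ℂ p μ))
    {E : Type w} [NormedAddCommGroup E] [NormedSpace ℂ E] (hE : IsQSLSpace p E) :
    RpowRotund p.toReal δ K E := by
  obtain ⟨X, _, μ, S, N, -, -, ⟨e⟩⟩ := hE
  have hS : RpowRotund p.toReal δ K S := fun f g => h X μ (f : Lp ℂ p μ) (g : Lp ℂ p μ)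
  exact hS.of_quotient ENNReal.toReal_nonneg hK N e

theorem exists_halfRotund_of_isQSLSpace (p : ℝ≥0∞) [Fact (1 ≤ p)] (h1 : 1 < p) (hp : p ≠ ∞) :
    ∃ K : ℝ, ∀ (E : Type w) [NormedAddCommGroup E] [NormedSpace ℂ E], IsQSLSpace p E →
      HalfRotund K E := by
  have hp1 : 1 < p.toReal := by
    rw [← ENNReal.toReal_one]
    exact (ENNReal.toReal_lt_toReal ENNReal.one_ne_top hp).2 h1
  set q := p.toReal with hq
  have hc : (0 : ℝ) < (1 / 2) ^ q := by positivity
  -- For unit vectors the `δ`-term is then `(1/2)^q / 2`, half of the lower bound for `‖x - y‖ ^ q`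
  -- when `‖x - y‖ > 1/2`; the defect must account for the rest.
  obtain ⟨K, hK, h⟩ := exists_norm_sub_rpow_le hp1 (show (0 : ℝ) < (1 / 2) ^ q / 4 by positivity)
  refine ⟨4 * K * q / (1 / 2) ^ q, fun E _ _ hE => HalfRotund.of_unit (by positivity)
    fun x y hx hy => ?_⟩
  have h2 : ‖x + y‖ ≤ 2 := (norm_add_le x y).trans (by rw [hx, hy]; norm_num)
  rcases le_or_gt ‖x - y‖ (1 / 2) with hxy | hxy
  · have : 0 ≤ 4 * K * q / (1 / 2) ^ q * (2 - ‖x + y‖) := mul_nonneg (by positivity) (by linarith)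
    linarith
  have hm : ‖(2⁻¹ : ℂ) • (x + y)‖ = 1 + (‖x + y‖ / 2 - 1) := by
    rw [norm_smul]; simp; ring
  -- Bernoulli's inequality makes the defect at most linear in `2 - ‖x + y‖`.
  have hbern : 1 + q * (‖x + y‖ / 2 - 1) ≤ ‖(2⁻¹ : ℂ) • (x + y)‖ ^ q := by
    rw [hm]
    exact one_add_mul_self_le_rpow_one_add (by linarith [norm_nonneg (x + y)]) hp1.le
  have hmain := RpowRotund.of_isQSLSpace hK (fun X _ μ => rpowRotund_Lp hp h) hE x y
  rw [← hq, hx, hy, Real.one_rpow] at hmain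
  have hlow : (1 / 2 : ℝ) ^ q < ‖x - y‖ ^ q :=
    Real.rpow_lt_rpow (by norm_num) hxy (by linarith)
  have hle : ‖x - y‖ ≤ 2 := (norm_sub_le x y).trans (by rw [hx, hy]; norm_num)
  have h3 : K * ((1 + 1) / 2 - ‖(2⁻¹ : ℂ) • (x + y)‖ ^ q) ≤ K * (q * (1 - ‖x + y‖ / 2)) :=
    mul_le_mul_of_nonneg_left (by linarith) hK
  have h4 : 2 ≤ 4 * K * q / (1 / 2) ^ q * (2 - ‖x + y‖) := by
    rw [div_mul_eq_mul_div, le_div_iff₀ hc]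
    nlinarith
  linarith

end QSL

/-! ### Permutation representations on `ℓ^p` -/

section PermutationRepresentation

variable {X : Type w} [MeasurableSpace X] [DiscreteMeasurableSpace X] {p : ℝ≥0∞} [Fact (1 ≤ p)]

theorem measurePreserving_perm_count (e : Equiv.Perm X) :
    MeasurePreserving e (Measure.count : Measure X) Measure.count := by
  refine ⟨.of_discrete, Measure.ext fun s hs => ?_⟩
  rw [Measure.map_apply .of_discrete hs, Measure.count_apply hs, Measure.count_apply .of_discrete]
  congr 1
  exact ENat.card_congr (e.subtypeEquiv fun _ => Iff.rfl)

variable (p) in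
/-- The linear isometry `f ↦ f ∘ e` of `ℓ^p(X)`. -/
noncomputable def lpPermComp (e : Equiv.Perm X) :
    Lp ℂ p (Measure.count : Measure X) →ₗᵢ[ℂ] Lp ℂ p (Measure.count : Measure X) :=
  Lp.compMeasurePreservingₗᵢ ℂ e (measurePreserving_perm_count e)

theorem lpPermComp_one (f : Lp ℂ p (Measure.count : Measure X)) : lpPermComp p 1 f = f :=
  Lp.compMeasurePreserving_id_apply f

theorem lpPermComp_mul (e e' : Equiv.Perm X) (f : Lp ℂ p (Measure.count : Measure X)) :
    lpPermComp p (e * e') f = lpPermComp p e' (lpPermComp p e f) :=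
  Lp.compMeasurePreserving_comp_apply f (measurePreserving_perm_count e)
    (measurePreserving_perm_count e')

variable (X p) in
/-- The permutation representation of `Perm X` on `ℓ^p(X)`. -/
noncomputable def lpPermHom :
    Equiv.Perm X →* (Lp ℂ p (Measure.count : Measure X) ≃ₗᵢ[ℂ] Lp ℂ p (Measure.count : Measure X))
    where
  -- Precomposition reverses products; the inverse restores the order and makes `δ_i` go to `δ_{e
  -- i}`.
  toFun e := LinearIsometryEquiv.ofSurjective (lpPermComp p e⁻¹) fun f =>
    ⟨lpPermComp p e f, by rw [← lpPermComp_mul, mul_inv_cancel, lpPermComp_one]⟩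
  map_one' := LinearIsometryEquiv.ext fun f => by
    change lpPermComp p 1⁻¹ f = f
    rw [inv_one, lpPermComp_one]
  map_mul' e e' := LinearIsometryEquiv.ext fun f => by
    change lpPermComp p (e * e')⁻¹ f = lpPermComp p e⁻¹ (lpPermComp p e'⁻¹ f)
    rw [mul_inv_rev, lpPermComp_mul]

variable (p) in
/-- The standard basis vectors of `ℓ^p(X)`. -/
noncomputable def lpDelta (i : X) : Lp ℂ p (Measure.count : Measure X) :=
  indicatorConstLp p (μ := Measure.count) (s := {i}) .of_discrete (by simp) 1

theorem lpPermHom_lpDelta (e : Equiv.Perm X) (i : X) :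
    lpPermHom X p e (lpDelta p i) = lpDelta p (e i) := by
  refine (Lp.indicatorConstLp_compMeasurePreserving _ _ _ _).trans ?_
  have : (e⁻¹ : Equiv.Perm X) ⁻¹' {i} = {e i} := by
    ext j
    simp only [Set.mem_preimage, Set.mem_singleton_iff, Equiv.Perm.inv_eq_iff_eq]
  simp only [lpDelta, this]

theorem eq_of_ae_eq_count {X β : Type*} [MeasurableSpace X] {f g : X → β} (h : f =ᵐ[Measure.count] g) (x : X) :
    f x = g x := by
  have := ae_iff.1 h
  rw [Measure.count_eq_zero_iff] at this
  by_contra hx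
  exact (this ▸ hx : x ∈ (∅ : Set X))

theorem lpDelta_apply {p : ℝ≥0∞} (i j : X) : lpDelta p i j = ({i} : Set X).indicator (fun _ => (1 : ℂ)) j :=
  eq_of_ae_eq_count indicatorConstLp_coeFn j

theorem norm_lpDelta (hp : p ≠ ∞) (i : X) : ‖lpDelta p i‖ = 1 := by
  have hp0 : p ≠ 0 := (zero_lt_one.trans_le (Fact.out : 1 ≤ p)).ne'
  rw [lpDelta, norm_indicatorConstLp hp0 hp]
  simp [Measure.real]

theorem norm_apply_le_norm_Lp_count (hp : p ≠ ∞) (f : Lp ℂ p (Measure.count : Measure X)) (i : X) :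
    ‖f i‖ ≤ ‖f‖ := by
  have hp0 : p ≠ 0 := (zero_lt_one.trans_le (Fact.out : 1 ≤ p)).ne'
  have h1 : eLpNorm (({i} : Set X).indicator f) p Measure.count ≤ eLpNorm f p Measure.count :=
    eLpNorm_indicator_le f
  have h2 : ({i} : Set X).indicator f = ({i} : Set X).indicator fun _ => f i := by
    ext j
    by_cases h : j = i <;> simp [h]
  rw [h2, eLpNorm_indicator_const .of_discrete hp0 hp, Measure.count_singleton,
    ENNReal.one_rpow, mul_one] at h1
  rw [Lp.norm_def, ← toReal_enorm]
  exact ENNReal.toReal_mono (Lp.eLpNorm_ne_top f) h1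

/-- Evaluation of an `ℓ^p` function at a point. -/
noncomputable def lpEval (hp : p ≠ ∞) (i : X) :
    StrongDual ℂ (Lp ℂ p (Measure.count : Measure X)) :=
  LinearMap.mkContinuous
    { toFun := fun f => f i
      map_add' := fun f g => eq_of_ae_eq_count (Lp.coeFn_add f g) i
      map_smul' := fun c f => eq_of_ae_eq_count (Lp.coeFn_smul c f) i }
    1 fun f => by simpa using norm_apply_le_norm_Lp_count hp f i

theorem lpEval_lpDelta (hp : p ≠ ∞) (i j : X) :
    lpEval hp j (lpDelta p i) = ({i} : Set X).indicator (fun _ => (1 : ℂ)) j :=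
  lpDelta_apply i j

theorem norm_lpEval (hp : p ≠ ∞) (i : X) : ‖lpEval hp i‖ = 1 := by
  refine le_antisymm (LinearMap.mkContinuous_norm_le _ zero_le_one _) ?_
  have h := (lpEval hp i).le_opNorm (lpDelta p i)
  simpa [lpEval_lpDelta, norm_lpDelta hp] using h

theorem dense_span_lpDelta (hp : p ≠ ∞) :
    Dense (Submodule.span ℂ (Set.range (lpDelta p (X := X))) :
      Set (Lp ℂ p (Measure.count : Measure X))) := by
  intro f
  refine Lp.induction hp (fun f => f ∈ closure
    (Submodule.span ℂ (Set.range (lpDelta p (X := X))) :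
      Set (Lp ℂ p (Measure.count : Measure X)))) ?_ ?_
    isClosed_closure f
  · intro c s hs hμs
    have hfin : s.Finite := Measure.count_apply_lt_top.1 hμs
    rw [Lp.simpleFunc.coe_indicatorConst]
    have : indicatorConstLp p hs hμs.ne c = ∑ i ∈ hfin.toFinset, c • lpDelta p i := by
      classical
      refine Lp.ext (Filter.Eventually.of_forall fun j => ?_)
      have h1 : ∀ g : Lp ℂ p (Measure.count : Measure X), g j = lpEval hp j g := fun _ => rfl
      rw [eq_of_ae_eq_count indicatorConstLp_coeFn j, h1, map_sum]
      simp only [map_smul, lpEval_lpDelta, Set.indicator_apply, Set.mem_singleton_iff, smul_eq_mul,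
        mul_ite, mul_one, mul_zero, Finset.sum_ite_eq, Set.Finite.mem_toFinset]
    rw [this]
    exact subset_closure (Submodule.sum_mem _ fun i _ =>
      Submodule.smul_mem _ _ (Submodule.subset_span ⟨i, rfl⟩))
  · intro f g hf hg _ h1 h2
    exact (Submodule.span ℂ (Set.range (lpDelta p (X := X)))).topologicalClosure.add_mem h1 h2

variable {G : Type u} [Group G] [TopologicalSpace G]

/-- An `ε/3` argument: isometries are equicontinuous, so continuity passes from a dense subspace to
all vectors. -/
theorem continuous_orbit_of_dense {E : Type*} [NormedAddCommGroup E] [NormedSpace ℂ E]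
    (π : G →* (E ≃ₗᵢ[ℂ] E)) {s : Set E} (hs : Dense (Submodule.span ℂ s : Set E))
    (h : ∀ ξ ∈ s, Continuous fun x => π x ξ) (ξ : E) : Continuous fun x => π x ξ := by
  have hspan : ∀ ξ ∈ Submodule.span ℂ s, Continuous fun x => π x ξ := fun ξ hξ => by
    induction hξ using Submodule.span_induction with
    | mem ξ hξ => exact h ξ hξ
    | zero => simpa using continuous_const
    | add ξ ζ _ _ h1 h2 => simp only [map_add]; exact h1.add h2
    | smul c ξ _ h1 => simp only [map_smul]; exact h1.const_smul c
  rw [Metric.continuous_iff'] at *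
  intro a ε hε
  obtain ⟨ζ, hζ, hd⟩ := Metric.dense_iff.1 hs ξ (ε / 3) (by positivity)
  have hd' : dist ξ ζ < ε / 3 := by rwa [dist_comm]
  filter_upwards [(Metric.continuous_iff'.1 (hspan ζ hd)) a (ε / 3) (by positivity)] with x hx
  have h1 : dist (π x ξ) (π x ζ) = dist ξ ζ := (π x).dist_map _ _
  have h2 : dist (π a ζ) (π a ξ) = dist ζ ξ := (π a).dist_map _ _
  have h3 := dist_triangle4 (π x ξ) (π x ζ) (π a ζ) (π a ξ)
  rw [h1, h2, dist_comm ζ] at h3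
  linarith

variable (p) in
/-- The representation of `G` on `ℓ^p(X)` given by an action of `G` on `X` with open
stabilizers. -/
noncomputable def lpActionRep (hp : p ≠ ∞) [MulAction G X]
    (hX : ∀ i j : X, IsOpen {x : G | x • i = j}) :
    BanachRep G (Lp ℂ p (Measure.count : Measure X)) where
  toHom := (lpPermHom X p).comp (MulAction.toPermHom G X)
  continuous_orbit := continuous_orbit_of_dense _ (dense_span_lpDelta hp) (by
    rintro _ ⟨i, rfl⟩
    have : (fun x : G => (lpPermHom X p).comp (MulAction.toPermHom G X) x (lpDelta p i)) =
        fun x => lpDelta p (x • i) := funext fun x => lpPermHom_lpDelta _ _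
    rw [this]
    refine IsLocallyConstant.continuous ((IsLocallyConstant.iff_exists_open _).2 fun x => ?_)
    exact ⟨{y | y • i = x • i}, hX _ _, rfl, fun y hy => congrArg (lpDelta p) hy⟩)

theorem lpActionRep_lpDelta (hp : p ≠ ∞) [MulAction G X]
    (hX : ∀ i j : X, IsOpen {x : G | x • i = j}) (x : G) (i : X) :
    (lpActionRep p hp hX).toHom x (lpDelta p i) = lpDelta p (x • i) :=
  lpPermHom_lpDelta _ _

theorem lpActionRep_coeff (hp : p ≠ ∞) [MulAction G X]
    (hX : ∀ i j : X, IsOpen {x : G | x • i = j}) (i j : X) :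
    (lpActionRep p hp hX).coeff (lpDelta p i) (lpEval hp j) = chi {x : G | x • i = j} := by
  ext x
  rw [BanachRep.coeff, lpActionRep_lpDelta, lpEval_lpDelta]
  by_cases h : x • i = j
  · rw [chi_apply_of_mem (show x ∈ {x : G | x • i = j} from h), Set.indicator_of_mem (Set.mem_singleton_iff.2 h.symm)]
  · rw [chi_apply_of_notMem (show x ∉ {x : G | x • i = j} from h),
      Set.indicator_of_notMem fun h' => h (Set.mem_singleton_iff.1 h').symm]

theorem isCyclic_lpActionRep [IsTopologicalGroup G] [LocallyCompactSpace G]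
    [MeasurableSpace G] [BorelSpace G] (hp : p ≠ ∞) [MulAction G X] [MulAction.IsPretransitive G X]
    [Nonempty X] (hX : ∀ i j : X, IsOpen {x : G | x • i = j}) :
    (lpActionRep p hp hX).IsCyclic := by
  obtain ⟨i⟩ := ‹Nonempty X›
  set π := lpActionRep p hp hX
  refine ⟨lpDelta p i, (dense_span_lpDelta hp).mono fun ζ hζ => ?_⟩
  -- Integrability of the vector-valued integrand is carried along so that integrals can be added.
  suffices h : ∃ f : G → ℂ, Integrable f (Measure.haar : Measure G) ∧
      Integrable (fun x => f x • π.toHom x (lpDelta p i)) (Measure.haar : Measure G) ∧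
      ζ = π.integrated f (lpDelta p i) by
    obtain ⟨f, hf, -, h⟩ := h
    exact ⟨f, hf, h⟩
  induction hζ using Submodule.span_induction with
  | mem ζ hζ =>
    obtain ⟨j, rfl⟩ := hζ
    obtain ⟨y, hy⟩ := MulAction.exists_smul_eq G i j
    obtain ⟨k, hk, hyk, hkj⟩ := exists_compact_subset (hX i j) (show y ∈ {x : G | x • i = j} from hy)
    have hm : MeasurableSet (interior k) := isOpen_interior.measurableSet
    have hμ : Measure.haar (interior k) ≠ ∞ :=
      ((measure_mono interior_subset).trans_lt hk.measure_lt_top).ne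
    have hμ0 : Measure.haar (interior k) ≠ 0 := (isOpen_interior.measure_pos _ ⟨y, hyk⟩).ne'
    -- On `interior k` the orbit map is constantly `δ_j`, so averaging over this set of finite
    -- positive measure gives `δ_j`.
    set f : G → ℂ := (interior k).indicator fun _ => ((Measure.haar.real (interior k))⁻¹ : ℂ)
    have hf : Integrable f (Measure.haar : Measure G) :=
      (integrable_indicator_iff hm).2 (integrableOn_const hμ)
    have hfδ : (fun x => f x • π.toHom x (lpDelta p i)) = fun x => f x • lpDelta p j := by
      ext1 x
      by_cases hx : x ∈ interior k
      · rw [lpActionRep_lpDelta, show x • i = j from hkj (interior_subset hx)]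
      · simp only [f, Set.indicator_of_notMem hx, zero_smul]
    refine ⟨f, hf, hfδ ▸ hf.smul_const _, ?_⟩
    rw [BanachRep.integrated, hfδ, integral_smul_const, integral_indicator_const _ hm]
    have : (Measure.haar.real (interior k) : ℂ) ≠ 0 :=
      Complex.ofReal_ne_zero.2 (ENNReal.toReal_ne_zero.2 ⟨hμ0, hμ⟩)
    rw [Complex.real_smul, mul_inv_cancel₀ this, one_smul]
  | zero => exact ⟨0, integrable_zero _ _ _, by simp, by simp [BanachRep.integrated]⟩
  | add ξ ζ _ _ h1 h2 =>
    obtain ⟨f, hf, hf', rfl⟩ := h1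
    obtain ⟨g, hg, hg', rfl⟩ := h2
    refine ⟨f + g, hf.add hg, ?_, ?_⟩
    · simp only [Pi.add_apply, add_smul]
      exact hf'.add hg'
    · simp only [BanachRep.integrated, Pi.add_apply, add_smul]
      exact (integral_add hf' hg').symm
  | smul c ξ _ h1 =>
    obtain ⟨f, hf, hf', rfl⟩ := h1
    refine ⟨c • f, hf.smul c, ?_, ?_⟩
    · simp only [Pi.smul_apply, smul_assoc]
      exact hf'.smul c
    · simp only [BanachRep.integrated, Pi.smul_apply, smul_assoc]
      exact (integral_smul c _).symm

/-- The quotient of a normed space by its zero subspace. -/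
noncomputable def quotBotIsometry (V : Type*) [NormedAddCommGroup V] [NormedSpace ℂ V] :
    V ≃ₗᵢ[ℂ] V ⧸ (⊥ : Submodule ℂ V) :=
  LinearIsometryEquiv.ofSurjective
    { toLinearMap := (⊥ : Submodule ℂ V).mkQ
      norm_map' := fun v => by
        refine le_antisymm (Submodule.Quotient.norm_mk_le _ v)
          (le_of_forall_pos_lt_add fun ε hε => ?_)
        obtain ⟨v', hv', hlt⟩ := Submodule.Quotient.norm_mk_lt
          (Submodule.Quotient.mk v : V ⧸ (⊥ : Submodule ℂ V)) hε
        rw [Submodule.Quotient.eq, Submodule.mem_bot, sub_eq_zero] at hv'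
        rwa [hv'] at hlt }
    (Submodule.mkQ_surjective _)

theorem isQSLSpace_Lp {X : Type w} [MeasurableSpace X] (μ : Measure X) :
    IsQSLSpace p (Lp ℂ p μ) :=
  ⟨X, _, μ, ⊤, ⊥, isClosed_univ, isClosed_singleton,
    ⟨(LinearIsometryEquiv.ofTop (R := ℂ) (Lp ℂ p μ) ⊤ rfl).symm.trans (quotBotIsometry _)⟩⟩

end PermutationRepresentation

/-! ### Open cosets as coefficients -/

section CoefficientOfCoset

/-- Uniqueness is the equality case of Cauchy–Schwarz, via the Riesz representation. -/
theorem isSmoothSpace_of_innerProductSpace (H : Type w) [NormedAddCommGroup H]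
    [InnerProductSpace ℂ H] [CompleteSpace H] : IsSmoothSpace H := by
  intro ξ hξ
  have hξ' : (‖ξ‖ : ℂ) ≠ 0 := Complex.ofReal_ne_zero.2 (norm_ne_zero_iff.2 hξ)
  refine ⟨InnerProductSpace.toDual ℂ H ((‖ξ‖ : ℂ)⁻¹ • ξ), ⟨?_, ?_⟩, ?_⟩
  · rw [LinearIsometryEquiv.norm_map, norm_smul, norm_inv, Complex.norm_real, norm_norm,
      inv_mul_cancel₀ (norm_ne_zero_iff.2 hξ)]
  · rw [InnerProductSpace.toDual_apply_apply, inner_smul_left, inner_self_eq_norm_sq_to_K, map_inv₀,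
      Complex.conj_ofReal, sq]
    exact inv_mul_cancel_left₀ hξ' _
  · rintro η ⟨h1, h2⟩
    obtain ⟨v, rfl⟩ := (InnerProductSpace.toDual ℂ H).surjective η
    rw [LinearIsometryEquiv.norm_map] at h1
    rw [InnerProductSpace.toDual_apply_apply] at h2
    have h3 : inner ℂ v ξ = (‖v‖ : ℂ) * ‖ξ‖ := by rw [h2, h1, Complex.ofReal_one, one_mul]
    have h4 := inner_eq_norm_mul_iff.1 h3
    rw [h1] at h4
    congr 1
    rw [eq_inv_smul_iff₀ hξ']
    simpa using h4

theorem chi_ne_zero {G : Type u} {C : Set G} (hC : C.Nonempty) : chi C ≠ 0 := by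
  obtain ⟨a, ha⟩ := hC
  intro h
  have := congrFun h a
  rw [chi_apply_of_mem ha] at this
  exact one_ne_zero this

variable {G : Type u} [Group G] [TopologicalSpace G]

/-- The action is that on `G ⧸ H`, lifted to the required universe; `aH` is the set of elements
carrying the base point to `aH`. -/
theorem IsOpenLeftCoset.exists_mulAction [IsTopologicalGroup G] {C : Set G}
    (hC : IsOpenLeftCoset C) :
    ∃ (X : Type (max u v)) (_ : MulAction G X) (i j : X), MulAction.IsPretransitive G X ∧
      (∀ i j : X, IsOpen {x : G | x • i = j}) ∧ C = {x : G | x • i = j} := by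
  obtain ⟨H, a, hH, rfl⟩ := hC
  have hmk : ∀ x g g' : G, x • ULift.up.{v} (g : G ⧸ H) = ULift.up (g' : G ⧸ H) ↔
      (x * g)⁻¹ * g' ∈ H := fun x g g' => by
    rw [← QuotientGroup.eq]
    exact ULift.up_inj
  refine ⟨ULift.{v} (G ⧸ H), inferInstance, ⟨((1 : G) : G ⧸ H)⟩, ⟨(a : G ⧸ H)⟩, ⟨?_⟩, ?_, ?_⟩
  · rintro ⟨i⟩ ⟨j⟩
    obtain ⟨g, rfl⟩ := MulAction.exists_smul_eq G i j
    exact ⟨g, rfl⟩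
  · rintro ⟨i⟩ ⟨j⟩
    obtain ⟨g, rfl⟩ := QuotientGroup.mk_surjective i
    obtain ⟨g', rfl⟩ := QuotientGroup.mk_surjective j
    simp only [hmk]
    exact hH.preimage (by fun_prop)
  · ext x
    change _ ↔ x • _ = _
    rw [hmk, mul_one]
    constructor
    · rintro ⟨h, hh, rfl⟩
      simpa using hh
    · intro h
      exact ⟨a⁻¹ * x, by simpa using H.inv_mem h, by simp⟩

theorem IsOpenLeftCoset.nonempty {C : Set G} (hC : IsOpenLeftCoset C) : C.Nonempty := by
  obtain ⟨H, a, -, rfl⟩ := hC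
  exact ⟨_, 1, H.one_mem, rfl⟩

/-- An open left coset is given by a unit vector and a unit functional of a unitary
representation. -/
theorem IsOpenLeftCoset.exists_unitary [IsTopologicalGroup G] {C : Set G}
    (hC : IsOpenLeftCoset C) :
    ∃ (H : Type (max u v)) (_ : NormedAddCommGroup H) (_ : InnerProductSpace ℂ H)
      (_ : CompleteSpace H) (π : BanachRep G H), π.IsNormalizedCoeff (chi C) := by
  obtain ⟨X, _, i, j, -, hX, rfl⟩ := IsOpenLeftCoset.exists_mulAction.{u, v} hC
  let _ : MeasurableSpace X := ⊤
  have h2 : (2 : ℝ≥0∞) ≠ ∞ := ENNReal.ofNat_ne_top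
  exact ⟨Lp ℂ 2 (Measure.count : Measure X), inferInstance, inferInstance, inferInstance,
    lpActionRep 2 h2 hX, lpDelta 2 i, lpEval h2 j, norm_lpDelta h2 i, norm_lpEval h2 j,
    (lpActionRep_coeff h2 hX i j).symm⟩

theorem IsOpenLeftCoset.chi_mem_fourierStieltjes [IsTopologicalGroup G] {C : Set G}
    (hC : IsOpenLeftCoset C) : chi C ∈ fourierStieltjes.{u, max u v} G ∧
      fourierStieltjesNorm.{u, max u v} (chi C) = 1 := by
  obtain ⟨H, i₁, i₂, i₃, π, ξ, η, hξ, hη, hu⟩ := IsOpenLeftCoset.exists_unitary.{u, v} hC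
  have hmem : (1 : ℝ) ∈ fourierStieltjesValues.{u, max u v} (chi C) := by
    obtain ⟨v, rfl⟩ := (InnerProductSpace.toDual ℂ H).surjective η
    rw [LinearIsometryEquiv.norm_map] at hη
    exact ⟨H, i₁, i₂, i₃, π, ξ, v, by rw [hξ, hη, one_mul], fun x => congrFun hu x⟩
  refine ⟨⟨1, hmem⟩, IsLeast.csInf_eq ⟨hmem, ?_⟩⟩
  rintro c ⟨H, _, _, _, π, ξ, η, rfl, hu⟩
  obtain ⟨a, ha⟩ := hC.nonempty
  have h := norm_inner_le_norm (𝕜 := ℂ) η (π.toHom a ξ)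
  rwa [← hu, chi_apply_of_mem ha, norm_one, LinearIsometryEquiv.norm_map, mul_comm] at h

theorem IsOpenLeftCoset.chi_mem_bpAlgebra [IsTopologicalGroup G] [LocallyCompactSpace G]
    [MeasurableSpace G] [BorelSpace G] {p : ℝ≥0∞} [Fact (1 ≤ p)] (hp : p ≠ ∞) {C : Set G}
    (hC : IsOpenLeftCoset C) :
    chi C ∈ bpAlgebra.{u, max u v} p G ∧ bpNorm.{u, max u v} p (chi C) = 1 := by
  have hne := hC.nonempty
  have hmem : (1 : ℝ) ∈ bpValues.{u, max u v} p (chi C) := by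
    obtain ⟨X, _, i, j, _, hX, rfl⟩ := IsOpenLeftCoset.exists_mulAction.{u, v} hC
    let _ : MeasurableSpace X := ⊤
    have : Nonempty X := ⟨i⟩
    let R : CycRep.{u, max u v} p G :=
      { E := Lp ℂ p (Measure.count : Measure X)
        rep := lpActionRep p hp hX
        isQSLSpace := isQSLSpace_Lp _
        isCyclic := isCyclic_lpActionRep hp hX }
    refine ⟨fun _ => R, (Pi.single 0 (lpDelta p i) : ℕ → Lp ℂ p (Measure.count : Measure X)),
      fun _ => lpEval hp j, ?_, fun x => ?_⟩
    · have h := hasSum_norm_single_mul_norm (lpDelta p i) (lpEval hp j)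
      rw [norm_lpDelta hp, norm_lpEval hp, one_mul] at h
      simpa [R, norm_lpEval hp] using h
    · rw [← lpActionRep_coeff hp hX i j]
      exact (lpActionRep p hp hX).hasSum_coeff_single _ _ x
  refine ⟨⟨1, hmem⟩, IsLeast.csInf_eq ⟨hmem, ?_⟩⟩
  rintro c ⟨R, ξ, η, hc, hu⟩
  exact one_le_of_hasSum_coeff hne (fun n => (R n).rep) ξ η hc hu

end CoefficientOfCoset


theorem mainTheorem3
    {G : Type u} [Group G] [TopologicalSpace G] [IsTopologicalGroup G] [T2Space G]
    [LocallyCompactSpace G] [MeasurableSpace G] [BorelSpace G]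
    (p : ℝ≥0∞) [Fact (1 ≤ p)] (hp_one : 1 < p) (hp_top : p < ∞) (C : Set G) :
    List.TFAE [
      IsOpenLeftCoset C,
      chi C ∈ fourierStieltjes.{u, max u v} G ∧ fourierStieltjesNorm.{u, max u v} (chi C) = 1,
      chi C ≠ 0 ∧ ∃ (E : Type (max u v)) (_ : NormedAddCommGroup E) (_ : NormedSpace ℂ E)
        (_ : CompleteSpace E) (π : BanachRep G E),
        (IsSmoothSpace E ∨ IsSmoothSpace (StrongDual ℂ E)) ∧ π.IsNormalizedCoeff (chi C),
      chi C ∈ bpAlgebra.{u, max u v} p G ∧ bpNorm.{u, max u v} p (chi C) = 1] := by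
  tfae_have 1 → 2 := IsOpenLeftCoset.chi_mem_fourierStieltjes.{u, v}
  tfae_have 2 → 1 := fun h => isOpenLeftCoset_of_fourierStieltjesNorm_eq_one h.1 h.2
  tfae_have 1 → 3 := fun h => by
    obtain ⟨H, i₁, i₂, i₃, π, hπ⟩ := IsOpenLeftCoset.exists_unitary.{u, v} h
    exact ⟨chi_ne_zero h.nonempty, H, i₁, inferInstance, i₃, π,
      Or.inl (isSmoothSpace_of_innerProductSpace H), hπ⟩
  tfae_have 3 → 1 := by
    rintro ⟨hC, E, _, _, _, π, hE, hπ⟩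
    exact isOpenLeftCoset_of_isNormalizedCoeff hC π hE hπ
  tfae_have 1 → 4 := IsOpenLeftCoset.chi_mem_bpAlgebra.{u, v} hp_top.ne
  tfae_have 4 → 1 := by
    obtain ⟨K, hK⟩ := exists_halfRotund_of_isQSLSpace.{max u v} p hp_one hp_top.ne
    exact fun h => isOpenLeftCoset_of_bpNorm_eq_one hK h.1 h.2
  tfae_finish
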